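/- **Theorem 5.1 (label stability).** Let $(M,g)$ be a finite-dimensional smooth Riemannian manifold (Hausdorff, without boundary), let $\mathbf F=(F_1,\dots,F_k):M\to\mathbb R^k$ be smooth, let $c$ be a regular value of $\mathbf F$, and let $S=\mathbf F^{-1}(c)$, a smooth embedded submanifold of $M$. Let $X_S$ be a smooth vector field on $S$ and $x_e\in S$ an equilibrium point of it, i.e. $X_S(x_e)=0$. Let $X$ be a smooth vector field on $M$ that extends $X_S$, i.e. $X|_S=X_S$, and let $G:M\to\mathbb R$ be a $C^2$ function that extends a function $G_S:S\to\mathbb R$. Gradients are taken with respect to $g$, and $\mathrm{Hess}\,f(x)(v,w)=\langle\nabla_v\,\mathrm{grad} f,w\rangle$ for $v,w\in T_xM$, where $\nabla$ is the Levi-Civita connection of $g$. For functions $f_1,\dots,f_r,h_1,\dots,h_s$ on $M$ let $\Sigma^{(f_1,\dots,f_r)}_{(h_1,\dots,h_s)}$ be the $r\times s$ matrix whose entry in row $a$ and column $b$ is $\langle\mathrm{grad}\,h_b,\mathrm{grad}\,f_a\rangle$, and put $$\sigma_i(x)=\frac{\det\Sigma^{(F_1,\dots,F_k)}_{(F_1,\dots,F_{i-1},G,F_{i+1},\dots,F_k)}(x)}{\det\Sigma^{(F_1,\dots,F_k)}_{(F_1,\dots,F_k)}(x)},\qquad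 i=1,\dots,k .$$ Suppose that (i) $\mathbf L_XG\le 0$ on $M$; (ii) $\mathrm{grad}\,G(x_e)=\sum_{i=1}^k\sigma_i(x_e)\,\mathrm{grad}\,F_i(x_e)$; (iii) the restriction of $\mathrm{Hess}\,G(x_e)-\sum_{i=1}^k\sigma_i(x_e)\,\mathrm{Hess}\,F_i(x_e)$ to $T_{x_e}S\times T_{x_e}S$ is positive definite. Then $x_e$ is a stable equilibrium of $X_S$: for each neighbourhood $U$ of $x_e$ in $S$ there is a neighbourhood $V$ of $x_e$ in $S$ such that from each point of $V$ there starts a solution of $\dot x=X_S(x)$ that exists for all $t\ge 0$, and all solutions that start in $V$, on whatever interval $[0,T)$, stay in $U$. -/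

import Mathlib

open scoped Manifold ContDiff Topology
open Set

noncomputable section

namespace ConstrainedStability

section Riemannian

variable {E : Type*} [NormedAddCommGroup E] [NormedSpace ℝ E] [FiniteDimensional ℝ E]
  {M : Type*} [TopologicalSpace M] [ChartedSpace E M] [IsManifold 𝓘(ℝ, E) ∞ M]

/-- The type of smooth Riemannian metrics on a (boundaryless, finite-dimensional) smooth manifold
`M` modelled on `E`. -/
abbrev SmoothMetric (E : Type*) [NormedAddCommGroup E] [NormedSpace ℝ E]
    (M : Type*) [TopologicalSpace M] [ChartedSpace E M] [IsManifold 𝓘(ℝ, E) ∞ M] :=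
  Bundle.ContMDiffRiemannianMetric 𝓘(ℝ, E) ∞ E (fun x : M ↦ TangentSpace 𝓘(ℝ, E) x)

/-- The scalar product of a Riemannian metric on one tangent space, as a bilinear form. -/
def metricForm (g : SmoothMetric E M) (x : M) :
    LinearMap.BilinForm ℝ (TangentSpace 𝓘(ℝ, E) x) :=
  LinearMap.mk₂ ℝ (fun v w ↦ g.inner x v w)
    (by intros; simp) (by intros; simp) (by intros; simp) (by intros; simp)

instance (x : M) : FiniteDimensional ℝ (TangentSpace 𝓘(ℝ, E) x) :=
  inferInstanceAs (FiniteDimensional ℝ E)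

theorem metricForm_nondegenerate (g : SmoothMetric E M) (x : M) :
    (metricForm g x).Nondegenerate := by
  refine ⟨fun v hv ↦ ?_, fun v hv ↦ ?_⟩ <;>
  · by_contra h
    exact (g.pos x v h).ne' (hv v)

/-- The musical isomorphism `♯`: `sharp g x ℓ` is the tangent vector with
`⟨sharp g x ℓ, w⟩ = ℓ w` for all `w`. -/
def sharp (g : SmoothMetric E M) (x : M) (l : TangentSpace 𝓘(ℝ, E) x →L[ℝ] ℝ) :
    TangentSpace 𝓘(ℝ, E) x :=
  ((metricForm g x).toDual (metricForm_nondegenerate g x)).symm l.toLinearMap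

theorem inner_sharp (g : SmoothMetric E M) (x : M) (l : TangentSpace 𝓘(ℝ, E) x →L[ℝ] ℝ)
    (w : TangentSpace 𝓘(ℝ, E) x) : g.inner x (sharp g x l) w = l w :=
  LinearMap.BilinForm.apply_toDual_symm_apply (hB := metricForm_nondegenerate g x)
    l.toLinearMap w

/-- The Riemannian gradient: `⟨grad f (x), w⟩ = df_x(w)` for all `w ∈ T_x M`. -/
def grad (g : SmoothMetric E M) (f : M → ℝ) (x : M) : TangentSpace 𝓘(ℝ, E) x :=
  sharp g x (mvfderiv 𝓘(ℝ, E) f x)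

/-- The differential at `y` of the preferred chart `φ` at `x`; it sends a tangent vector at `y` to
its coordinate vector. -/
def chartDeriv (x y : M) : TangentSpace 𝓘(ℝ, E) y →L[ℝ] E :=
  mfderiv 𝓘(ℝ, E) 𝓘(ℝ, E) (extChartAt 𝓘(ℝ, E) x) y

/-- The differential at `p` of the inverse `φ⁻¹` of the preferred chart at `x`; it sends a coordinate
vector to the corresponding tangent vector at `φ⁻¹ p`. -/
def chartSymmDeriv (x : M) (p : E) :
    E →L[ℝ] TangentSpace 𝓘(ℝ, E) ((extChartAt 𝓘(ℝ, E) x).symm p) :=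
  mfderiv 𝓘(ℝ, E) 𝓘(ℝ, E) (extChartAt 𝓘(ℝ, E) x).symm p

/-- The metric read in the preferred chart `φ` at `x` (pull-back of `g` by `φ⁻¹`): at the point `p`
of the model space it is `(a, b) ↦ g (dφ⁻¹_p a, dφ⁻¹_p b)`. -/
def coordMetric (g : SmoothMetric E M) (x : M) (p : E) : E →L[ℝ] E →L[ℝ] ℝ :=
  (ContinuousLinearMap.precomp ℝ (chartSymmDeriv x p)) ∘L
    (g.inner ((extChartAt 𝓘(ℝ, E) x).symm p)) ∘L (chartSymmDeriv x p)

theorem coordMetric_apply (g : SmoothMetric E M) (x : M) (p a b : E) :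
    coordMetric g x p a b = g.inner ((extChartAt 𝓘(ℝ, E) x).symm p)
      (chartSymmDeriv x p a) (chartSymmDeriv x p b) := rfl

/-- The Christoffel symbols of the first kind at `x`, in the preferred chart at `x`, as a linear
form in the last argument:
`c ↦ ½ (∂_a g(b, c) + ∂_b g(a, c) - ∂_c g(a, b))`. -/
def christoffelFirst (g : SmoothMetric E M) (x : M) (a b : E) : E →L[ℝ] ℝ :=
  let D : E →L[ℝ] E →L[ℝ] E →L[ℝ] ℝ := fderiv ℝ (coordMetric g x) (extChartAt 𝓘(ℝ, E) x x)
  (1 / 2 : ℝ) • (D a b + D b a - (D.flip a).flip b)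

theorem christoffelFirst_apply (g : SmoothMetric E M) (x : M) (a b c : E) :
    christoffelFirst g x a b c = 1 / 2 *
      (fderiv ℝ (coordMetric g x) (extChartAt 𝓘(ℝ, E) x x) a b c
        + fderiv ℝ (coordMetric g x) (extChartAt 𝓘(ℝ, E) x x) b a c
        - fderiv ℝ (coordMetric g x) (extChartAt 𝓘(ℝ, E) x x) c a b) := by
  simp [christoffelFirst]

/-- The coordinate expression, in the preferred chart at `x`, of a vector field `Y`. -/
def coordField (Y : (x : M) → TangentSpace 𝓘(ℝ, E) x) (x : M) (p : E) : E :=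
  chartDeriv x ((extChartAt 𝓘(ℝ, E) x).symm p) (Y ((extChartAt 𝓘(ℝ, E) x).symm p))

/-- The Levi-Civita covariant derivative `∇_v Y` at `x` of a vector field `Y` differentiable at `x`,
in the direction `v ∈ T_x M`. It is the classical formula
`(∇_v Y)^m = ∂_v Y^m + Γ^m_{ij} v^i Y^j` in the preferred chart at `x`, with the index `m` lowered:
the linear form `w ↦ g(∂_v Y, w) + Γ(v, Y, w)`, with `Γ` the Christoffel symbols of the first kind,
to which `♯` is applied. -/
def leviCivita (g : SmoothMetric E M) (Y : (x : M) → TangentSpace 𝓘(ℝ, E) x) (x : M)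
    (v : TangentSpace 𝓘(ℝ, E) x) : TangentSpace 𝓘(ℝ, E) x :=
  sharp g x
    ((coordMetric g x (extChartAt 𝓘(ℝ, E) x x)
        (fderiv ℝ (coordField Y x) (extChartAt 𝓘(ℝ, E) x x) (chartDeriv x x v))
      + christoffelFirst g x (chartDeriv x x v) (chartDeriv x x (Y x))) ∘L chartDeriv x x)

theorem inner_leviCivita (g : SmoothMetric E M) (Y : (x : M) → TangentSpace 𝓘(ℝ, E) x) (x : M)
    (v w : TangentSpace 𝓘(ℝ, E) x) :
    g.inner x (leviCivita g Y x v) w =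
      coordMetric g x (extChartAt 𝓘(ℝ, E) x x)
        (fderiv ℝ (coordField Y x) (extChartAt 𝓘(ℝ, E) x x) (chartDeriv x x v))
        (chartDeriv x x w)
      + christoffelFirst g x (chartDeriv x x v) (chartDeriv x x (Y x)) (chartDeriv x x w) :=
  inner_sharp g x _ w

/-- The Hessian of `f` at `x`: the bilinear form `(v, w) ↦ ⟨∇_v grad f, w⟩` on `T_x M`. -/
def hess (g : SmoothMetric E M) (f : M → ℝ) (x : M) (v w : TangentSpace 𝓘(ℝ, E) x) : ℝ :=
  g.inner x (leviCivita g (grad g f) x v) w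

/-- The Gramian matrix of two families of functions at a point; the entry in row `a` and column `b`
is `⟨grad h_b, grad f_a⟩`. -/
def gramian (g : SmoothMetric E M) {r s : ℕ} (f : Fin r → M → ℝ) (h : Fin s → M → ℝ) (x : M) :
    Matrix (Fin r) (Fin s) ℝ :=
  Matrix.of fun a b ↦ g.inner x (grad g (h b) x) (grad g (f a) x)

/-- The multiplier functions `σ_i`: the quotient by the Gramian determinant of `(F_1, …, F_k)` of
the determinant of the Gramian whose lower family has `F_i` replaced by `G`. -/
def multiplier (g : SmoothMetric E M) {k : ℕ} (F : Fin k → M → ℝ) (G : M → ℝ) (i : Fin k)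
    (x : M) : ℝ :=
  (gramian g F (Function.update F i G) x).det / (gramian g F F x).det

/-- Smoothness of a vector field. -/
def IsSmoothVectorField (X : (x : M) → TangentSpace 𝓘(ℝ, E) x) : Prop :=
  ContMDiff 𝓘(ℝ, E) (𝓘(ℝ, E).tangent) ∞ (fun x ↦ (⟨x, X x⟩ : TangentBundle 𝓘(ℝ, E) M))

end Riemannian

/-- `c` is a regular value of `F : M → ℝ^k`: the differential of `F` is onto at each point of the
fibre over `c`. -/
def IsRegularValue {E : Type*} [NormedAddCommGroup E] [NormedSpace ℝ E]
    {M : Type*} [TopologicalSpace M] [ChartedSpace E M] {k : ℕ}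
    (F : M → EuclideanSpace ℝ (Fin k)) (c : EuclideanSpace ℝ (Fin k)) : Prop :=
  ∀ x : M, F x = c →
    Function.Surjective (mfderiv 𝓘(ℝ, E) 𝓘(ℝ, EuclideanSpace ℝ (Fin k)) F x)

/-- The tangent space `T_x S`, as a subspace of `T_x M`, of a submanifold `S` of `M`: the image of
the differential of the inclusion. -/
def tangentSubspace {E E' : Type*} [NormedAddCommGroup E] [NormedSpace ℝ E]
    [NormedAddCommGroup E'] [NormedSpace ℝ E']
    {M : Type*} [TopologicalSpace M] [ChartedSpace E M] {S : Set M} [ChartedSpace E' S] (x : S) :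
    Submodule ℝ (TangentSpace 𝓘(ℝ, E) (x : M)) :=
  (mfderiv 𝓘(ℝ, E') 𝓘(ℝ, E) (Subtype.val : S → M) x).range

/-- `x` is a (Lyapunov) stable equilibrium of the vector field `X` on the manifold `N`: `X` vanishes
at `x`, and for each neighbourhood `U` of `x` there is a neighbourhood `V` of `x` such that from
each point of `V` there starts a solution defined for all times `t ≥ 0`, and all solutions
that start in `V`, on whatever interval `[0, T)`, stay in `U`. -/
def IsStableEquilibrium {E : Type*} [NormedAddCommGroup E] [NormedSpace ℝ E]
    {N : Type*} [TopologicalSpace N] [ChartedSpace E N]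
    (X : (x : N) → TangentSpace 𝓘(ℝ, E) x) (x : N) : Prop :=
  X x = 0 ∧ ∀ U ∈ 𝓝 x, ∃ V ∈ 𝓝 x, ∀ y ∈ V,
    (∃ γ : ℝ → N, γ 0 = y ∧ IsMIntegralCurveOn γ X (Ici 0)) ∧
    ∀ (γ : ℝ → N) (T : ℝ), γ 0 = y → IsMIntegralCurveOn γ X (Ico 0 T) → ∀ t ∈ Ico 0 T, γ t ∈ U

end ConstrainedStability

end

/-!
By (ii) the function `Φ = G - ∑ σ_a F_a`, with the multipliers fixed at their values at `x_e`, is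
critical at `x_e`. At a critical point the Christoffel terms of the Hessian drop out, and the
second derivative transforms as a bilinear form, so it may be computed after restriction to `S`.
There `Φ` and `G` differ by a constant, hence (iii) makes `x_e` a strict local minimum of `G|_S`.

Since `G` decreases along solutions, a solution starting in a small chart ball at a point where `G`
is below its minimum `m` over the boundary sphere can never reach that sphere. Solutions exist for
all times because the field, cut off in the chart to a compactly supported field on a vector space,
is complete, and the trapped solutions do not see the cutoff.
-/

namespace ConstrainedStability

open Filter Metric

section SecondDerivativeTest

variable {V : Type*} [NormedAddCommGroup V] [NormedSpace ℝ V]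

theorem isCoercive_of_pos [FiniteDimensional ℝ V] {A : V →L[ℝ] V →L[ℝ] ℝ}
    (hA : ∀ u, u ≠ 0 → 0 < A u u) : IsCoercive A := by
  obtain ⟨C, hC, hCA⟩ := (isCompact_sphere (0 : V) 1).exists_forall_le'
    (f := fun u ↦ A u u) (by fun_prop) fun u hu ↦ hA u (ne_zero_of_mem_unit_sphere ⟨u, hu⟩)
  refine ⟨C, hC, fun u ↦ ?_⟩
  rcases eq_or_ne u 0 with rfl | hu
  · simp
  have hn : ‖u‖ ≠ 0 := norm_ne_zero_iff.2 hu
  have hmem : ‖u‖⁻¹ • u ∈ sphere (0 : V) 1 := by simp [norm_smul, hn]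
  calc C * ‖u‖ * ‖u‖ ≤ A (‖u‖⁻¹ • u) (‖u‖⁻¹ • u) * ‖u‖ * ‖u‖ := by gcongr; exact hCA _ hmem
    _ = A u u := by
      simp only [map_smul, smul_apply, smul_eq_mul]
      field_simp

theorem eventually_pos_apply_sub_of_hasFDerivAt {h' : V → V →L[ℝ] ℝ} {A : V →L[ℝ] V →L[ℝ] ℝ}
    {x : V} (hA : HasFDerivAt h' A x) (hx : h' x = 0) (hAc : IsCoercive A) :
    ∀ᶠ y in 𝓝 x, y ≠ x → 0 < h' y (y - x) := by
  obtain ⟨C, hC, hCA⟩ := hAc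
  filter_upwards [hA.isLittleO.def (half_pos hC)] with y hy hne
  rw [hx, sub_zero] at hy
  have hpos : 0 < ‖y - x‖ := norm_pos_iff.2 (sub_ne_zero.2 hne)
  have hrem : |(h' y - A (y - x)) (y - x)| ≤ C / 2 * ‖y - x‖ * ‖y - x‖ :=
    ((h' y - A (y - x)).le_opNorm (y - x)).trans (by gcongr)
  have hmain : C / 2 * ‖y - x‖ * ‖y - x‖ < A (y - x) (y - x) :=
    lt_of_lt_of_le (by gcongr; linarith) (hCA (y - x))
  rw [sub_apply] at hrem
  linarith [(abs_le.1 hrem).1]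

theorem lt_of_forall_pos_fderiv_apply_sub {h : V → ℝ} {x : V} {r : ℝ}
    (hd : ∀ y ∈ ball x r, DifferentiableAt ℝ h y)
    (hpos : ∀ y ∈ ball x r, y ≠ x → 0 < fderiv ℝ h y (y - x)) {y : V} (hy : y ∈ ball x r)
    (hne : y ≠ x) : h x < h y := by
  have hline : ∀ t : ℝ, HasDerivAt (AffineMap.lineMap x y) (y - x) t := fun t ↦
    AffineMap.hasDerivAt_lineMap
  have hmem : ∀ t ∈ Icc (0 : ℝ) 1, AffineMap.lineMap x y t ∈ ball x r := fun t ht ↦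
    (convex_ball x r).lineMap_mem (mem_ball_self (dist_nonneg.trans_lt hy)) hy ht
  have hder : ∀ t ∈ Icc (0 : ℝ) 1, HasDerivAt (fun t : ℝ ↦ h (AffineMap.lineMap x y t))
      (fderiv ℝ h (AffineMap.lineMap x y t) (y - x)) t := fun t ht ↦
    (hd _ (hmem t ht)).hasFDerivAt.comp_hasDerivAt t (hline t)
  have hmono : StrictMonoOn (fun t : ℝ ↦ h (AffineMap.lineMap x y t)) (Icc 0 1) := by
    refine strictMonoOn_of_deriv_pos (convex_Icc 0 1)
      (fun t ht ↦ (hder t ht).continuousAt.continuousWithinAt) fun t ht ↦ ?_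
    rw [interior_Icc] at ht
    have ht' : t ∈ Icc (0 : ℝ) 1 := Ioo_subset_Icc_self ht
    have hsub : AffineMap.lineMap x y t - x = t • (y - x) := by
      simp [AffineMap.lineMap_apply]
    have hradial := hpos _ (hmem t ht') (sub_ne_zero.1 (by
      rw [hsub]
      exact smul_ne_zero ht.1.ne' (sub_ne_zero.2 hne)))
    rw [hsub, map_smul, smul_eq_mul] at hradial
    rw [(hder t ht').deriv]
    exact pos_of_mul_pos_right hradial ht.1.le
  simpa using hmono (left_mem_Icc.2 zero_le_one) (right_mem_Icc.2 zero_le_one) zero_lt_one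

theorem eventually_lt_of_fderiv_fderiv_pos [FiniteDimensional ℝ V] {h : V → ℝ} {x : V}
    (hh : ContDiffAt ℝ 2 h x) (hx : fderiv ℝ h x = 0)
    (hpos : ∀ u, u ≠ 0 → 0 < fderiv ℝ (fderiv ℝ h) x u u) :
    ∀ᶠ y in 𝓝 x, y ≠ x → h x < h y := by
  have hh' : HasFDerivAt (fderiv ℝ h) (fderiv ℝ (fderiv ℝ h) x) x :=
    ((hh.fderiv_right (m := 1) le_rfl).differentiableAt one_ne_zero).hasFDerivAt
  have hd : ∀ᶠ y in 𝓝 x, DifferentiableAt ℝ h y :=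
    (hh.eventually (by simp)).mono fun y hy ↦ hy.differentiableAt two_ne_zero
  obtain ⟨r, hr, hball⟩ := eventually_nhds_iff_ball.1
    (hd.and (eventually_pos_apply_sub_of_hasFDerivAt hh' hx (isCoercive_of_pos hpos)))
  filter_upwards [ball_mem_nhds x hr] with y hy
  exact lt_of_forall_pos_fderiv_apply_sub (fun z hz ↦ (hball z hz).1)
    (fun z hz ↦ (hball z hz).2) hy

theorem fderiv_fderiv_comp_of_fderiv_eq_zero {W : Type*} [NormedAddCommGroup W] [NormedSpace ℝ W]
    {h : V → ℝ} {j : W → V} {x : W} (hh : ContDiffAt ℝ 2 h (j x)) (hj : ContDiffAt ℝ 2 j x)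
    (hx : fderiv ℝ h (j x) = 0) (u w : W) :
    fderiv ℝ (fderiv ℝ (h ∘ j)) x u w =
      fderiv ℝ (fderiv ℝ h) (j x) (fderiv ℝ j x u) (fderiv ℝ j x w) := by
  have hjd := hj.differentiableAt two_ne_zero
  have hh' := (hh.fderiv_right (m := 1) le_rfl).differentiableAt one_ne_zero
  have hj' := (hj.fderiv_right (m := 1) le_rfl).differentiableAt one_ne_zero
  have heq : fderiv ℝ (h ∘ j) =ᶠ[𝓝 x] fun q ↦ ((fderiv ℝ h ∘ j) q).comp (fderiv ℝ j q) := by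
    filter_upwards [hj.eventually (by simp),
      hjd.continuousAt.eventually (hh.eventually (by simp))] with q hjq hhq
    exact fderiv_comp q (hhq.differentiableAt two_ne_zero) (hjq.differentiableAt two_ne_zero)
  rw [heq.fderiv_eq,
    ((hh'.hasFDerivAt.comp x hjd.hasFDerivAt).clm_comp hj'.hasFDerivAt).fderiv]
  simp [hx]

end SecondDerivativeTest

section Trapping

theorem mem_of_le_initial {α β : Type*} [TopologicalSpace α] [LinearOrder β] {K O : Set α}
    (hK : IsClosed K) (hO : IsOpen O) (hOK : O ⊆ K) {f : α → β} {m : β}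
    (hm : ∀ y ∈ K \ O, m ≤ f y) {γ : ℝ → α} {T : ℝ} (hT : 0 ≤ T) (hγ : ContinuousOn γ (Icc 0 T))
    (h0 : γ 0 ∈ O) (hf0 : f (γ 0) < m)
    (hle : ∀ t ∈ Icc 0 T, (∀ s ∈ Icc 0 t, γ s ∈ K) → f (γ t) ≤ f (γ 0)) : γ T ∈ O := by
  by_contra hTO
  have hcomp : IsCompact (Icc 0 T ∩ γ ⁻¹' Oᶜ) :=
    isCompact_Icc.of_isClosed_subset
      (hγ.preimage_isClosed_of_isClosed isClosed_Icc hO.isClosed_compl) inter_subset_left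
  obtain ⟨s, ⟨hsT, hsO⟩, hmin⟩ := hcomp.exists_isLeast ⟨T, ⟨hT, le_rfl⟩, hTO⟩
  have hbefore : MapsTo γ (Ico 0 s) O := fun t ht ↦ by
    by_contra h
    exact (hmin ⟨⟨ht.1, ht.2.le.trans hsT.2⟩, h⟩).not_gt ht.2
  have hs0 : 0 ≠ s := by
    rintro rfl
    exact hsO h0
  have huntil : MapsTo γ (Icc 0 s) K := by
    rw [← closure_Ico hs0, ← hK.closure_eq]
    refine (hbefore.mono_right hOK).closure_of_continuousOn ?_
    rw [closure_Ico hs0]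
    exact hγ.mono (Icc_subset_Icc_right hsT.2)
  have hexit : m ≤ f (γ s) := hm _ ⟨huntil ⟨hsT.1, le_rfl⟩, hsO⟩
  exact (hexit.trans (hle s hsT huntil)).not_gt hf0

end Trapping

section CompactlySupportedFields

variable {V : Type*} [NormedAddCommGroup V] [NormedSpace ℝ V] [FiniteDimensional ℝ V]

theorem exists_contDiff_hasCompactSupport_eventuallyEq {W : Type*} [NormedAddCommGroup W]
    [NormedSpace ℝ W] {n : ℕ} {Z : V → W} {x : V} (hZ : ContDiffAt ℝ n Z x) :
    ∃ v : V → W, ContDiff ℝ n v ∧ HasCompactSupport v ∧ v =ᶠ[𝓝 x] Z := by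
  obtain ⟨r, hr, hball⟩ := eventually_nhds_iff_ball.1 (hZ.eventually (by simp))
  let χ : ContDiffBump x := ⟨r / 3, r / 2, by positivity, by linarith⟩
  have hsupp : tsupport χ ⊆ ball x r := by
    rw [χ.tsupport_eq]
    exact closedBall_subset_ball (half_lt_self hr)
  refine ⟨fun q ↦ χ q • Z q, contDiff_iff_contDiffAt.2 fun q ↦ ?_,
    χ.hasCompactSupport.smul_right, ?_⟩
  · by_cases hq : q ∈ ball x r
    · exact χ.contDiffAt.smul (hball q hq)
    · have hzero : (fun q ↦ χ q • Z q) =ᶠ[𝓝 q] fun _ ↦ 0 := by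
        filter_upwards [notMem_tsupport_iff_eventuallyEq.1 fun h ↦ hq (hsupp h)] with z hz
        simp [hz]
      exact contDiffAt_const.congr_of_eventuallyEq hzero
  · filter_upwards [χ.eventuallyEq_one] with q hq
    simp [hq]

theorem exists_forall_hasDerivAt_of_hasCompactSupport {v : V → V} (hv : ContDiff ℝ 1 v)
    (hsupp : HasCompactSupport v) (x : V) :
    ∃ β : ℝ → V, β 0 = x ∧ ∀ t, HasDerivAt β (v (β t)) t := by
  have : CompleteSpace V := FiniteDimensional.complete ℝ V
  obtain ⟨K, hK⟩ := ContDiff.lipschitzWith_of_hasCompactSupport hsupp hv one_ne_zero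
  obtain ⟨C, hC⟩ := hsupp.exists_bound_of_continuous hv.continuous
  lift C to NNReal using (norm_nonneg _).trans (hC x)
  have hvM : ContMDiff 𝓘(ℝ, V) 𝓘(ℝ, V).tangent 1
      (fun x ↦ (⟨x, v x⟩ : TangentBundle 𝓘(ℝ, V) V)) :=
    contMDiff_vectorSpace_iff_contDiff.2 hv
  obtain ⟨β, hβ0, hβ⟩ := (exists_isMIntegralCurve_iff_exists_isMIntegralCurveOn_Ioo hvM x).2 <| by
    intro a
    have h0 : (0 : ℝ) ∈ Icc (-|a|) |a| := ⟨by simp, by simp⟩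
    -- `‖v‖ ≤ C` everywhere, so Picard–Lindelöf on the ball of radius `C * |a|` reaches time `|a|`
    have hPL : IsPicardLindelof (fun _ ↦ v) (⟨0, h0⟩ : Icc (-|a|) |a|) x (C * ‖a‖₊) 0 C K :=
      { lipschitzOnWith := fun t _ ↦ hK.lipschitzOnWith
        continuousOn := fun y _ ↦ continuousOn_const
        norm_le := fun t _ y _ ↦ hC y
        mul_max_le := by simp }
    obtain ⟨α, hα0, hα⟩ := hPL.exists_eq_forall_mem_Icc_hasDerivWithinAt₀
    refine ⟨α, hα0, fun t ht ↦ HasMFDerivAt.hasMFDerivWithinAt ?_⟩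
    have ht' : t ∈ Ioo (-|a|) |a| := Ioo_subset_Ioo (neg_le_neg (le_abs_self a)) (le_abs_self a) ht
    have hαt := (hα t (Ioo_subset_Icc_self ht')).hasDerivAt (Icc_mem_nhds ht'.1 ht'.2)
    exact hαt.hasFDerivAt.hasMFDerivAt
  refine ⟨β, hβ0, fun t ↦ ?_⟩
  have hβt : HasFDerivAt β ((1 : ℝ →L[ℝ] ℝ).smulRight (v (β t))) t := (hβ t).hasFDerivAt
  simpa using hβt.hasDerivAt

end CompactlySupportedFields

section Charts

variable {E : Type*} [NormedAddCommGroup E] [NormedSpace ℝ E]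
  {M : Type*} [TopologicalSpace M] [ChartedSpace E M]
  {E' : Type*} [NormedAddCommGroup E'] [NormedSpace ℝ E']
  {N : Type*} [TopologicalSpace N] [ChartedSpace E' N]

theorem contDiffAt_writtenInExtChartAt {n : WithTop ℕ∞} {f : N → M} {x : N}
    (hf : ContMDiffAt 𝓘(ℝ, E') 𝓘(ℝ, E) n f x) :
    ContDiffAt ℝ n (writtenInExtChartAt 𝓘(ℝ, E') 𝓘(ℝ, E) x f) (extChartAt 𝓘(ℝ, E') x x) := by
  have h := (contMDiffAt_iff.1 hf).2
  rwa [modelWithCornersSelf_coe, range_id, contDiffWithinAt_univ] at h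

theorem mfderiv_eq_fderiv_writtenInExtChartAt {f : N → M} {x : N}
    (hf : MDifferentiableAt 𝓘(ℝ, E') 𝓘(ℝ, E) f x) :
    mfderiv 𝓘(ℝ, E') 𝓘(ℝ, E) f x =
      fderiv ℝ (writtenInExtChartAt 𝓘(ℝ, E') 𝓘(ℝ, E) x f) (extChartAt 𝓘(ℝ, E') x x) := by
  rw [hf.mfderiv, modelWithCornersSelf_coe, range_id, fderivWithin_univ]

theorem contDiffAt_comp_extChartAt_symm {n : WithTop ℕ∞} {f : M → ℝ} {x : M}
    (hf : ContMDiffAt 𝓘(ℝ, E) 𝓘(ℝ, ℝ) n f x) :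
    ContDiffAt ℝ n (f ∘ (extChartAt 𝓘(ℝ, E) x).symm) (extChartAt 𝓘(ℝ, E) x x) :=
  contDiffAt_writtenInExtChartAt hf

theorem mvfderiv_eq_fderiv_comp_extChartAt_symm {f : M → ℝ} {x : M}
    (hf : MDifferentiableAt 𝓘(ℝ, E) 𝓘(ℝ, ℝ) f x) :
    mvfderiv 𝓘(ℝ, E) f x =
      fderiv ℝ (f ∘ (extChartAt 𝓘(ℝ, E) x).symm) (extChartAt 𝓘(ℝ, E) x x) :=
  mfderiv_eq_fderiv_writtenInExtChartAt hf

theorem tendsto_extChartAt_symm (x : M) :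
    Tendsto (extChartAt 𝓘(ℝ, E) x).symm (𝓝 (extChartAt 𝓘(ℝ, E) x x)) (𝓝 x) := by
  simpa only [extChartAt_to_inv] using (continuousAt_extChartAt_symm (I := 𝓘(ℝ, E)) x).tendsto

variable [IsManifold 𝓘(ℝ, E) 1 M]

theorem mdifferentiableAt_extChartAt_symm {x : M} {p : E}
    (hp : p ∈ (extChartAt 𝓘(ℝ, E) x).target) :
    MDifferentiableAt 𝓘(ℝ, E) 𝓘(ℝ, E) (extChartAt 𝓘(ℝ, E) x).symm p :=
  (mdifferentiableOn_extChartAt_symm p hp).mdifferentiableAt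
    ((isOpen_extChartAt_target x).mem_nhds hp)

theorem chartDeriv_self (x : M) : chartDeriv x x = ContinuousLinearMap.id ℝ E :=
  mfderiv_extChartAt_self

theorem chartDeriv_chartSymmDeriv {x : M} {p : E} (hp : p ∈ (extChartAt 𝓘(ℝ, E) x).target)
    (a : E) : chartDeriv x _ (chartSymmDeriv x p a) = a := by
  have h := mfderiv_extChartAt_comp_mfderivWithin_extChartAt_symm hp
  simp only [modelWithCornersSelf_coe, range_id, mfderivWithin_univ] at h
  exact DFunLike.congr_fun h a

theorem chartSymmDeriv_chartDeriv {x : M} {p : E} (hp : p ∈ (extChartAt 𝓘(ℝ, E) x).target)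
    (v : TangentSpace 𝓘(ℝ, E) ((extChartAt 𝓘(ℝ, E) x).symm p)) :
    chartSymmDeriv x p (chartDeriv x _ v) = v := by
  have h := mfderivWithin_extChartAt_symm_comp_mfderiv_extChartAt hp
  simp only [modelWithCornersSelf_coe, range_id, mfderivWithin_univ] at h
  exact DFunLike.congr_fun h v

theorem mvfderiv_chartSymmDeriv {f : M → ℝ} {x : M} {p : E}
    (hp : p ∈ (extChartAt 𝓘(ℝ, E) x).target)
    (hf : MDifferentiableAt 𝓘(ℝ, E) 𝓘(ℝ, ℝ) f ((extChartAt 𝓘(ℝ, E) x).symm p)) (a : E) :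
    mvfderiv 𝓘(ℝ, E) f _ (chartSymmDeriv x p a) =
      fderiv ℝ (f ∘ (extChartAt 𝓘(ℝ, E) x).symm) p a := by
  rw [← mfderiv_eq_fderiv]
  exact (mfderiv_comp_apply p hf (mdifferentiableAt_extChartAt_symm hp) a).symm

theorem coordField_extChartAt_self (X : (x : M) → TangentSpace 𝓘(ℝ, E) x) (x : M) :
    coordField X x (extChartAt 𝓘(ℝ, E) x x) = X x := by
  have h : ∀ y, y = x → (chartDeriv x y (X y) : E) = X x := by
    rintro _ rfl
    rw [chartDeriv_self]
    rfl
  exact h _ (extChartAt_to_inv x)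

theorem contDiffAt_coordField {n : WithTop ℕ∞} {X : (x : M) → TangentSpace 𝓘(ℝ, E) x} {x : M}
    (hX : ContMDiffAt 𝓘(ℝ, E) 𝓘(ℝ, E).tangent n
      (fun y ↦ (⟨y, X y⟩ : TangentBundle 𝓘(ℝ, E) M)) x) :
    ContDiffAt ℝ n (coordField X x) (extChartAt 𝓘(ℝ, E) x x) := by
  have h := (contMDiffAt_iff.1 hX).2
  rw [modelWithCornersSelf_coe, range_id, contDiffWithinAt_univ] at h
  refine h.snd.congr_of_eventuallyEq ?_
  filter_upwards [(isOpen_extChartAt_target (I := 𝓘(ℝ, E)) x).mem_nhds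
    (mem_extChartAt_target x)] with p hp
  have hsrc : (extChartAt 𝓘(ℝ, E) x).symm p ∈ (chartAt E x).source := by
    simpa using (extChartAt 𝓘(ℝ, E) x).map_target hp
  exact DFunLike.congr_fun (mfderiv_chartAt_eq_tangentCoordChange (I := 𝓘(ℝ, E)) hsrc) _

theorem isMIntegralCurveOn_extChartAt_symm_comp {X : (x : M) → TangentSpace 𝓘(ℝ, E) x} {x : M}
    {β : ℝ → E} {s : Set ℝ} (hs : ∀ t ∈ s, β t ∈ (extChartAt 𝓘(ℝ, E) x).target)
    (hβ : ∀ t ∈ s, HasDerivAt β (coordField X x (β t)) t) :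
    IsMIntegralCurveOn ((extChartAt 𝓘(ℝ, E) x).symm ∘ β) X s := by
  intro t ht
  have h := (mdifferentiableAt_extChartAt_symm (hs t ht)).hasMFDerivAt.comp t
    (hβ t ht).hasFDerivAt.hasMFDerivAt
  refine (h.congr_mfderiv ?_).hasMFDerivWithinAt
  ext
  change chartSymmDeriv x (β t) ((1 : ℝ) • coordField X x (β t)) =
    (1 : ℝ) • X ((extChartAt 𝓘(ℝ, E) x).symm (β t))
  rw [one_smul, one_smul]
  exact chartSymmDeriv_chartDeriv (hs t ht) _

end Charts

section LagrangeFunction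

/-- The Lagrange function `G - ∑ a, σ a * f a` of the minimization of `G` under constraints on the
functions `f a`, with multipliers `σ`. -/
def lagrangeFunction {α κ : Type*} [Fintype κ] (G : α → ℝ) (f : κ → α → ℝ) (σ : κ → ℝ) (x : α) :
    ℝ :=
  G x - ∑ a, σ a * f a x

variable {V κ : Type*} [NormedAddCommGroup V] [NormedSpace ℝ V] [Fintype κ]
  {G : V → ℝ} {f : κ → V → ℝ} {x : V}

theorem fderiv_lagrangeFunction (hG : DifferentiableAt ℝ G x)
    (hf : ∀ a, DifferentiableAt ℝ (f a) x) (σ : κ → ℝ) :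
    fderiv ℝ (lagrangeFunction G f σ) x = fderiv ℝ G x - ∑ a, σ a • fderiv ℝ (f a) x :=
  (hG.hasFDerivAt.sub
    (HasFDerivAt.fun_sum fun a _ ↦ (hf a).hasFDerivAt.const_mul (σ a))).fderiv

theorem fderiv_fderiv_lagrangeFunction (hG : ContDiffAt ℝ 2 G x)
    (hf : ∀ a, ContDiffAt ℝ 2 (f a) x) (σ : κ → ℝ) :
    fderiv ℝ (fderiv ℝ (lagrangeFunction G f σ)) x =
      fderiv ℝ (fderiv ℝ G) x - ∑ a, σ a • fderiv ℝ (fderiv ℝ (f a)) x := by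
  have heq : fderiv ℝ (lagrangeFunction G f σ) =ᶠ[𝓝 x]
      fun y ↦ fderiv ℝ G y - ∑ a, σ a • fderiv ℝ (f a) y := by
    filter_upwards [hG.eventually (by simp),
      eventually_all.2 fun a ↦ (hf a).eventually (by simp)] with y hGy hfy
    exact fderiv_lagrangeFunction (hGy.differentiableAt two_ne_zero)
      (fun a ↦ (hfy a).differentiableAt two_ne_zero) σ
  have hd : ∀ {h : V → ℝ}, ContDiffAt ℝ 2 h x →
      HasFDerivAt (fderiv ℝ h) (fderiv ℝ (fderiv ℝ h) x) x := fun hh ↦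
    ((hh.fderiv_right (m := 1) le_rfl).differentiableAt one_ne_zero).hasFDerivAt
  rw [heq.fderiv_eq]
  exact ((hd hG).sub (HasFDerivAt.fun_sum fun a _ ↦ (hd (hf a)).const_smul (σ a))).fderiv

variable {E M : Type*} [NormedAddCommGroup E] [NormedSpace ℝ E] [TopologicalSpace M]
  [ChartedSpace E M] {G : M → ℝ} {f : κ → M → ℝ} {x : M}

theorem contMDiffAt_lagrangeFunction {n : WithTop ℕ∞} (hG : ContMDiffAt 𝓘(ℝ, E) 𝓘(ℝ, ℝ) n G x)
    (hf : ∀ a, ContMDiffAt 𝓘(ℝ, E) 𝓘(ℝ, ℝ) n (f a) x) (σ : κ → ℝ) :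
    ContMDiffAt 𝓘(ℝ, E) 𝓘(ℝ, ℝ) n (lagrangeFunction G f σ) x :=
  hG.sub (contMDiffAt_finsetSum fun a _ ↦ contMDiffAt_const.mul (hf a))

theorem mvfderiv_lagrangeFunction (hG : MDifferentiableAt 𝓘(ℝ, E) 𝓘(ℝ, ℝ) G x)
    (hf : ∀ a, MDifferentiableAt 𝓘(ℝ, E) 𝓘(ℝ, ℝ) (f a) x) (σ : κ → ℝ) :
    mvfderiv 𝓘(ℝ, E) (lagrangeFunction G f σ) x =
      mvfderiv 𝓘(ℝ, E) G x - ∑ a, σ a • mvfderiv 𝓘(ℝ, E) (f a) x := by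
  have hL : HasMFDerivAt 𝓘(ℝ, E) 𝓘(ℝ, ℝ) (lagrangeFunction G f σ) x
      (mvfderiv 𝓘(ℝ, E) G x - ∑ a, σ a • mvfderiv 𝓘(ℝ, E) (f a) x) :=
    ⟨hG.continuousAt.sub (tendsto_finsetSum _ fun a _ ↦ (hf a).continuousAt.const_mul (σ a)),
      hG.hasMFDerivAt.2.sub
        (HasFDerivWithinAt.fun_sum fun a _ ↦ (hf a).hasMFDerivAt.2.const_mul (σ a))⟩
  exact hL.mfderiv

end LagrangeFunction

section CoordinateFields

variable {E : Type*} [NormedAddCommGroup E] [NormedSpace ℝ E]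
  {M : Type*} [TopologicalSpace M] [ChartedSpace E M]

theorem contMDiffAt_chartSymmDeriv [IsManifold 𝓘(ℝ, E) 2 M] {x : M} {p : E}
    (hp : p ∈ (extChartAt 𝓘(ℝ, E) x).target) (a : E) :
    ContMDiffAt 𝓘(ℝ, E) 𝓘(ℝ, E).tangent 1
      (fun q ↦ (⟨(extChartAt 𝓘(ℝ, E) x).symm q, chartSymmDeriv x q a⟩ :
        TangentBundle 𝓘(ℝ, E) M)) p := by
  have hopen := isOpen_extChartAt_target (I := 𝓘(ℝ, E)) x
  have htangent := (contMDiffOn_extChartAt_symm (I := 𝓘(ℝ, E)) (n := 2)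
    x).contMDiffOn_tangentMapWithin (m := 1) le_rfl hopen.uniqueMDiffOn
  have hconst : ContMDiff 𝓘(ℝ, E) 𝓘(ℝ, E).tangent 1
      (fun q : E ↦ (⟨q, a⟩ : TangentBundle 𝓘(ℝ, E) E)) :=
    contMDiff_vectorSpace_iff_contDiff.2 contDiff_const
  have hcomp := htangent.comp hconst.contMDiffOn fun _ hq ↦ hq
  refine (hcomp.contMDiffAt (hopen.mem_nhds hp)).congr_of_eventuallyEq ?_
  filter_upwards [hopen.mem_nhds hp] with q hq
  simp only [Function.comp, tangentMapWithin, mfderivWithin_of_isOpen hopen hq]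
  rfl

end CoordinateFields

section Hessian

variable {E : Type*} [NormedAddCommGroup E] [NormedSpace ℝ E] [FiniteDimensional ℝ E]
  {M : Type*} [TopologicalSpace M] [ChartedSpace E M] [IsManifold 𝓘(ℝ, E) ∞ M]
  (g : SmoothMetric E M) {f : M → ℝ} {x : M} {p : E}

theorem contDiffOn_coordMetric (x : M) :
    ContDiffOn ℝ 1 (coordMetric g x) (extChartAt 𝓘(ℝ, E) x).target := by
  refine contDiffOn_clm_apply.2 fun a ↦ contDiffOn_clm_apply.2 fun b p hp ↦ ?_
  have hsymm := (contMDiffOn_extChartAt_symm (I := 𝓘(ℝ, E)) (n := 1) x).contMDiffAt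
    ((isOpen_extChartAt_target x).mem_nhds hp)
  have hg : ContMDiffAt 𝓘(ℝ, E) (𝓘(ℝ, E).prod 𝓘(ℝ, E →L[ℝ] E →L[ℝ] ℝ)) 1
      (fun q ↦ Bundle.TotalSpace.mk' (E →L[ℝ] E →L[ℝ] ℝ)
        (E := fun x : M ↦ TangentSpace 𝓘(ℝ, E) x →L[ℝ] TangentSpace 𝓘(ℝ, E) x →L[ℝ] ℝ)
        ((extChartAt 𝓘(ℝ, E) x).symm q) (g.inner ((extChartAt 𝓘(ℝ, E) x).symm q))) p :=
    (g.contMDiff.of_le (by simp)).contMDiffAt.comp p hsymm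
  have h := hg.clm_bundle_apply₂ (F₁ := E) (F₂ := E) (F₃ := ℝ) (E₃ := fun _ : M ↦ ℝ)
    (contMDiffAt_chartSymmDeriv hp a) (contMDiffAt_chartSymmDeriv hp b)
  rw [Bundle.contMDiffAt_totalSpace] at h
  exact h.2.contDiffAt.contDiffWithinAt

theorem contDiffAt_coordMetric (hp : p ∈ (extChartAt 𝓘(ℝ, E) x).target) :
    ContDiffAt ℝ 1 (coordMetric g x) p :=
  (contDiffOn_coordMetric g x).contDiffAt ((isOpen_extChartAt_target x).mem_nhds hp)

theorem isInvertible_coordMetric (hp : p ∈ (extChartAt 𝓘(ℝ, E) x).target) :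
    (coordMetric g x p).IsInvertible := by
  have hinj : Function.Injective (coordMetric g x p).toLinearMap := by
    refine LinearMap.ker_eq_bot.1 (LinearMap.ker_eq_bot'.2 fun a ha ↦ ?_)
    have hsymm : chartSymmDeriv x p a = 0 := by
      by_contra hne
      have hpos := g.pos _ _ hne
      rw [← coordMetric_apply] at hpos
      exact hpos.ne' (DFunLike.congr_fun ha a)
    rw [← chartDeriv_chartSymmDeriv hp a, hsymm, map_zero]
  have hdim : Module.finrank ℝ E = Module.finrank ℝ (E →L[ℝ] ℝ) := by
    rw [← (LinearMap.toContinuousLinearMap (𝕜 := ℝ) (E := E) (F' := ℝ)).finrank_eq]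
    exact Subspace.dual_finrank_eq.symm
  exact ⟨(LinearEquiv.ofInjectiveOfFinrankEq _ hinj hdim).toContinuousLinearEquiv, rfl⟩

theorem coordMetric_coordField_grad (hp : p ∈ (extChartAt 𝓘(ℝ, E) x).target)
    (hf : MDifferentiableAt 𝓘(ℝ, E) 𝓘(ℝ, ℝ) f ((extChartAt 𝓘(ℝ, E) x).symm p)) :
    coordMetric g x p (coordField (grad g f) x p) =
      fderiv ℝ (f ∘ (extChartAt 𝓘(ℝ, E) x).symm) p := by
  ext a
  rw [coordMetric_apply, coordField, chartSymmDeriv_chartDeriv hp, grad, inner_sharp,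
    mvfderiv_chartSymmDeriv hp hf]

theorem eventually_coordMetric_coordField_grad (hf : ContMDiffAt 𝓘(ℝ, E) 𝓘(ℝ, ℝ) 1 f x) :
    ∀ᶠ p in 𝓝 (extChartAt 𝓘(ℝ, E) x x), p ∈ (extChartAt 𝓘(ℝ, E) x).target ∧
      coordMetric g x p (coordField (grad g f) x p) =
        fderiv ℝ (f ∘ (extChartAt 𝓘(ℝ, E) x).symm) p := by
  filter_upwards [(isOpen_extChartAt_target (I := 𝓘(ℝ, E)) x).mem_nhds
    (mem_extChartAt_target x), (tendsto_extChartAt_symm x).eventually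
      ((contMDiffAt_iff_contMDiffAt_nhds (by simp)).1 hf)] with p hp hfp
  exact ⟨hp, coordMetric_coordField_grad g hp (hfp.mdifferentiableAt one_ne_zero)⟩

theorem differentiableAt_coordField_grad (hf : ContMDiffAt 𝓘(ℝ, E) 𝓘(ℝ, ℝ) 2 f x) :
    DifferentiableAt ℝ (coordField (grad g f) x) (extChartAt 𝓘(ℝ, E) x x) := by
  have : CompleteSpace E := FiniteDimensional.complete ℝ E
  have hp := mem_extChartAt_target (I := 𝓘(ℝ, E)) x
  have hinv : DifferentiableAt ℝ (fun q ↦ (coordMetric g x q).inverse)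
      (extChartAt 𝓘(ℝ, E) x x) := by
    obtain ⟨L, hL⟩ := isInvertible_coordMetric g hp
    have h := contDiffAt_map_inverse (𝕜 := ℝ) (n := 1) L
    rw [hL] at h
    exact (h.comp _ (contDiffAt_coordMetric g hp)).differentiableAt one_ne_zero
  have hdf := ((contDiffAt_comp_extChartAt_symm hf).fderiv_right (m := 1)
    le_rfl).differentiableAt one_ne_zero
  refine (hinv.clm_apply hdf).congr_of_eventuallyEq ?_
  filter_upwards [eventually_coordMetric_coordField_grad g (hf.of_le one_le_two)]
    with q ⟨hq, hgrad⟩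
  rw [← hgrad, (isInvertible_coordMetric g hq).inverse_apply_self]

theorem fderiv_coordMetric_swap (hp : p ∈ (extChartAt 𝓘(ℝ, E) x).target) (a b c : E) :
    fderiv ℝ (coordMetric g x) p a b c = fderiv ℝ (coordMetric g x) p a c b := by
  have hd := ((contDiffAt_coordMetric g hp).differentiableAt one_ne_zero).hasFDerivAt
  have happly : ∀ b c, HasFDerivAt (fun q ↦ coordMetric g x q b c)
      (((fderiv ℝ (coordMetric g x) p).flip b).flip c) p := fun b c ↦ by
    simpa using (hd.clm_apply (hasFDerivAt_const b p)).clm_apply (hasFDerivAt_const c p)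
  have hsymm : (fun q ↦ coordMetric g x q b c) = fun q ↦ coordMetric g x q c b :=
    funext fun q ↦ g.symm _ _ _
  exact DFunLike.congr_fun ((happly b c).unique (hsymm ▸ happly c b)) a

theorem hess_eq_fderiv_fderiv_sub_christoffelFirst (hf : ContMDiffAt 𝓘(ℝ, E) 𝓘(ℝ, ℝ) 2 f x)
    (v w : TangentSpace 𝓘(ℝ, E) x) :
    hess g f x v w =
      fderiv ℝ (fderiv ℝ (f ∘ (extChartAt 𝓘(ℝ, E) x).symm)) (extChartAt 𝓘(ℝ, E) x x) v w
        - christoffelFirst g x v w (grad g f x) := by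
  have hp := mem_extChartAt_target (I := 𝓘(ℝ, E)) x
  have hlower := (eventually_coordMetric_coordField_grad g (hf.of_le one_le_two)).mono
    fun _ h ↦ h.2
  have hprod := ((contDiffAt_coordMetric g hp).differentiableAt one_ne_zero).hasFDerivAt.clm_apply
    (differentiableAt_coordField_grad g hf).hasFDerivAt
  have hhess : hess g f x v w = coordMetric g x (extChartAt 𝓘(ℝ, E) x x)
      (fderiv ℝ (coordField (grad g f) x) (extChartAt 𝓘(ℝ, E) x x) v) w +
        christoffelFirst g x v (grad g f x) w := by
    rw [hess, inner_leviCivita, chartDeriv_self]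
    rfl
  have hleibniz : fderiv ℝ (fderiv ℝ (f ∘ (extChartAt 𝓘(ℝ, E) x).symm))
      (extChartAt 𝓘(ℝ, E) x x) v w = coordMetric g x (extChartAt 𝓘(ℝ, E) x x)
      (fderiv ℝ (coordField (grad g f) x) (extChartAt 𝓘(ℝ, E) x x) v) w +
        fderiv ℝ (coordMetric g x) (extChartAt 𝓘(ℝ, E) x x) v (grad g f x) w := by
    rw [← EventuallyEq.fderiv_eq hlower, hprod.fderiv, coordField_extChartAt_self]
    rfl
  linear_combination hhess - hleibniz + christoffelFirst_apply g x v (grad g f x) w +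
    christoffelFirst_apply g x v w (grad g f x) +
    fderiv_coordMetric_swap g hp v w (grad g f x) / 2

theorem sharp_sub_sum_smul {κ : Type*} [Fintype κ] (l : TangentSpace 𝓘(ℝ, E) x →L[ℝ] ℝ)
    (m : κ → TangentSpace 𝓘(ℝ, E) x →L[ℝ] ℝ) (σ : κ → ℝ) :
    sharp g x (l - ∑ a, σ a • m a) = sharp g x l - ∑ a, σ a • sharp g x (m a) := by
  simp [sharp]

variable {κ : Type*} [Fintype κ] {G : M → ℝ} {h : κ → M → ℝ}

theorem grad_lagrangeFunction (hG : MDifferentiableAt 𝓘(ℝ, E) 𝓘(ℝ, ℝ) G x)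
    (hh : ∀ a, MDifferentiableAt 𝓘(ℝ, E) 𝓘(ℝ, ℝ) (h a) x) (σ : κ → ℝ) :
    grad g (lagrangeFunction G h σ) x = grad g G x - ∑ a, σ a • grad g (h a) x := by
  rw [grad, mvfderiv_lagrangeFunction hG hh, sharp_sub_sum_smul]
  rfl

theorem hess_lagrangeFunction (hG : ContMDiffAt 𝓘(ℝ, E) 𝓘(ℝ, ℝ) 2 G x)
    (hh : ∀ a, ContMDiffAt 𝓘(ℝ, E) 𝓘(ℝ, ℝ) 2 (h a) x) (σ : κ → ℝ)
    (v w : TangentSpace 𝓘(ℝ, E) x) :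
    hess g (lagrangeFunction G h σ) x v w = hess g G x v w - ∑ a, σ a * hess g (h a) x v w := by
  have hD : ∀ b c : E, fderiv ℝ (fderiv ℝ (lagrangeFunction G h σ ∘ (extChartAt 𝓘(ℝ, E) x).symm))
      (extChartAt 𝓘(ℝ, E) x x) b c =
      fderiv ℝ (fderiv ℝ (G ∘ (extChartAt 𝓘(ℝ, E) x).symm)) (extChartAt 𝓘(ℝ, E) x x) b c -
        ∑ a, σ a * fderiv ℝ (fderiv ℝ (h a ∘ (extChartAt 𝓘(ℝ, E) x).symm))
          (extChartAt 𝓘(ℝ, E) x x) b c :=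
    fun b c ↦ by
      have hcomp : lagrangeFunction G h σ ∘ (extChartAt 𝓘(ℝ, E) x).symm =
          lagrangeFunction (G ∘ (extChartAt 𝓘(ℝ, E) x).symm)
            (fun a ↦ h a ∘ (extChartAt 𝓘(ℝ, E) x).symm) σ := rfl
      rw [hcomp, fderiv_fderiv_lagrangeFunction (contDiffAt_comp_extChartAt_symm hG)
        fun a ↦ contDiffAt_comp_extChartAt_symm (hh a)]
      simp
  let Γ : TangentSpace 𝓘(ℝ, E) x →ₗ[ℝ] ℝ := (christoffelFirst g x v w).toLinearMap
  have hΓ : ∀ {f : M → ℝ}, ContMDiffAt 𝓘(ℝ, E) 𝓘(ℝ, ℝ) 2 f x → hess g f x v w =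
      fderiv ℝ (fderiv ℝ (f ∘ (extChartAt 𝓘(ℝ, E) x).symm)) (extChartAt 𝓘(ℝ, E) x x) v w
        - Γ (grad g f x) := fun hf ↦ hess_eq_fderiv_fderiv_sub_christoffelFirst g hf v w
  rw [hΓ (contMDiffAt_lagrangeFunction hG hh σ),
    grad_lagrangeFunction g (hG.mdifferentiableAt two_ne_zero)
      fun a ↦ (hh a).mdifferentiableAt two_ne_zero]
  simp only [hΓ hG, hΓ (hh _), map_sub, map_sum, map_smul, smul_eq_mul, mul_sub,
    Finset.sum_sub_distrib]
  linear_combination hD v w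

end Hessian

section Lyapunov

variable {E : Type*} [NormedAddCommGroup E] [NormedSpace ℝ E]
  {N : Type*} [TopologicalSpace N] [ChartedSpace E N]
  {X : (x : N) → TangentSpace 𝓘(ℝ, E) x} {h : N → ℝ} {x₀ : N} {r m : ℝ}

theorem le_of_isMIntegralCurveOn {γ : ℝ → N} {t : ℝ} (ht : 0 ≤ t)
    (hγ : IsMIntegralCurveOn γ X (Icc 0 t))
    (hh : ∀ s ∈ Icc 0 t, MDifferentiableAt 𝓘(ℝ, E) 𝓘(ℝ, ℝ) h (γ s))
    (hX : ∀ s ∈ Icc 0 t, mvfderiv 𝓘(ℝ, E) h (γ s) (X (γ s)) ≤ 0) : h (γ t) ≤ h (γ 0) := by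
  have hder : ∀ s ∈ Icc 0 t, HasDerivWithinAt (h ∘ γ) (mvfderiv 𝓘(ℝ, E) h (γ s) (X (γ s)))
      (Icc 0 t) s := by
    intro s hs
    have hcomp : HasFDerivWithinAt (h ∘ γ) ((mvfderiv 𝓘(ℝ, E) h (γ s)).comp
        ((1 : ℝ →L[ℝ] ℝ).smulRight (X (γ s)))) (Icc 0 t) s :=
      ((hh s hs).hasMFDerivAt.comp_hasMFDerivWithinAt s (hγ s hs)).hasFDerivWithinAt
    refine hcomp.hasDerivWithinAt.congr_deriv ?_
    change mvfderiv 𝓘(ℝ, E) h (γ s) ((1 : ℝ) • X (γ s)) = _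
    rw [one_smul]
  have hanti : AntitoneOn (h ∘ γ) (Icc 0 t) :=
    antitoneOn_of_hasDerivWithinAt_nonpos (convex_Icc 0 t)
      (fun s hs ↦ (hder s hs).continuousWithinAt)
      (fun s hs ↦ (hder s (interior_subset hs)).mono interior_subset)
      fun s hs ↦ hX s (interior_subset hs)
  exact hanti (left_mem_Icc.2 ht) (right_mem_Icc.2 ht) ht

/-- A ball around `x₀`, read in the preferred chart at `x₀`, on which `h` is a Lyapunov function of
`X` and from which no integral curve can escape while `h < m`, since `h ≥ m` on its boundary. -/
structure IsLyapunovBall (X : (x : N) → TangentSpace 𝓘(ℝ, E) x) (h : N → ℝ) (x₀ : N) (r m : ℝ) :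
    Prop where
  subset_target : closedBall (extChartAt 𝓘(ℝ, E) x₀ x₀) r ⊆ (extChartAt 𝓘(ℝ, E) x₀).target
  mdifferentiableAt : ∀ q ∈ closedBall (extChartAt 𝓘(ℝ, E) x₀ x₀) r,
    MDifferentiableAt 𝓘(ℝ, E) 𝓘(ℝ, ℝ) h ((extChartAt 𝓘(ℝ, E) x₀).symm q)
  mvfderiv_nonpos : ∀ q ∈ closedBall (extChartAt 𝓘(ℝ, E) x₀ x₀) r,
    mvfderiv 𝓘(ℝ, E) h _ (X ((extChartAt 𝓘(ℝ, E) x₀).symm q)) ≤ 0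
  le_of_mem_sphere : ∀ q ∈ sphere (extChartAt 𝓘(ℝ, E) x₀ x₀) r,
    m ≤ h ((extChartAt 𝓘(ℝ, E) x₀).symm q)

theorem exists_isLyapunovBall [FiniteDimensional ℝ E]
    (hh : ∀ᶠ x in 𝓝 x₀, MDifferentiableAt 𝓘(ℝ, E) 𝓘(ℝ, ℝ) h x)
    (hXh : ∀ᶠ x in 𝓝 x₀, mvfderiv 𝓘(ℝ, E) h x (X x) ≤ 0)
    (hmin : ∀ᶠ x in 𝓝 x₀, x ≠ x₀ → h x₀ < h x) {P : E → Prop}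
    (hP : ∀ᶠ q in 𝓝 (extChartAt 𝓘(ℝ, E) x₀ x₀), P q) :
    ∃ r m, 0 < r ∧ h x₀ < m ∧ IsLyapunovBall X h x₀ r m ∧
      ∀ q ∈ closedBall (extChartAt 𝓘(ℝ, E) x₀ x₀) r, P q := by
  have htarget := (isOpen_extChartAt_target (I := 𝓘(ℝ, E)) x₀).eventually_mem
    (mem_extChartAt_target x₀)
  obtain ⟨r, hr, hball⟩ := nhds_basis_closedBall.eventually_iff.1 (htarget.and
    (((tendsto_extChartAt_symm x₀).eventually (hh.and (hXh.and hmin))).and hP))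
  have hcont : ContinuousOn (h ∘ (extChartAt 𝓘(ℝ, E) x₀).symm)
      (sphere (extChartAt 𝓘(ℝ, E) x₀ x₀) r) := fun q hq ↦
    have hq' := hball (sphere_subset_closedBall hq)
    (hq'.2.1.1.continuousAt.comp (continuousAt_extChartAt_symm'' hq'.1)).continuousWithinAt
  obtain ⟨m, hm, hle⟩ := (isCompact_sphere _ r).exists_forall_le' hcont fun q hq ↦ by
    obtain ⟨hqt, ⟨-, -, hlt⟩, -⟩ := hball (sphere_subset_closedBall hq)
    exact hlt fun hq₀ ↦ ne_of_mem_sphere hq hr.ne'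
      (((extChartAt 𝓘(ℝ, E) x₀).right_inv hqt).symm.trans (congrArg _ hq₀))
  exact ⟨r, m, hr, hm, ⟨fun q hq ↦ (hball hq).1, fun q hq ↦ (hball hq).2.1.1,
    fun q hq ↦ (hball hq).2.1.2.1, hle⟩, fun q hq ↦ (hball hq).2.2⟩

theorem IsLyapunovBall.mem_image_ball [FiniteDimensional ℝ E] [T2Space N]
    (hB : IsLyapunovBall X h x₀ r m) {γ : ℝ → N} {T : ℝ} (hT : 0 ≤ T)
    (hγ : IsMIntegralCurveOn γ X (Icc 0 T))
    (h0 : γ 0 ∈ (extChartAt 𝓘(ℝ, E) x₀).symm '' ball (extChartAt 𝓘(ℝ, E) x₀ x₀) r)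
    (hm : h (γ 0) < m) :
    γ T ∈ (extChartAt 𝓘(ℝ, E) x₀).symm '' ball (extChartAt 𝓘(ℝ, E) x₀ x₀) r := by
  have hclosed : IsClosed
      ((extChartAt 𝓘(ℝ, E) x₀).symm '' closedBall (extChartAt 𝓘(ℝ, E) x₀ x₀) r) :=
    ((isCompact_closedBall _ r).image_of_continuousOn
      ((continuousOn_extChartAt_symm x₀).mono hB.subset_target)).isClosed
  have hopen : IsOpen ((extChartAt 𝓘(ℝ, E) x₀).symm '' ball (extChartAt 𝓘(ℝ, E) x₀ x₀) r) :=
    (chartAt E x₀).isOpen_image_symm_of_subset_target isOpen_ball fun q hq ↦ by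
      simpa using hB.subset_target (ball_subset_closedBall hq)
  refine mem_of_le_initial hclosed hopen (image_mono ball_subset_closedBall) ?_ hT
    hγ.continuousOn h0 hm fun t ht hs ↦ ?_
  · rintro _ ⟨⟨q, hq, rfl⟩, hqb⟩
    refine hB.le_of_mem_sphere q ?_
    rw [← closedBall_sdiff_ball]
    exact ⟨hq, fun hq' ↦ hqb (mem_image_of_mem _ hq')⟩
  · refine le_of_isMIntegralCurveOn ht.1 (hγ.mono (Icc_subset_Icc_right ht.2))
      (fun s hst ↦ ?_) fun s hst ↦ ?_
    all_goals
      obtain ⟨q, hq, hqs⟩ := hs s hst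
      rw [← hqs]
    exacts [hB.mdifferentiableAt q hq, hB.mvfderiv_nonpos q hq]

variable [FiniteDimensional ℝ E] [IsManifold 𝓘(ℝ, E) 1 N]

theorem IsLyapunovBall.exists_isMIntegralCurveOn_Ici (hB : IsLyapunovBall X h x₀ r m) {v : E → E}
    (hv : ContDiff ℝ 1 v) (hsupp : HasCompactSupport v)
    (hvX : ∀ q ∈ closedBall (extChartAt 𝓘(ℝ, E) x₀ x₀) r, v q = coordField X x₀ q) {q : E}
    (hq : q ∈ ball (extChartAt 𝓘(ℝ, E) x₀ x₀) r)
    (hqm : h ((extChartAt 𝓘(ℝ, E) x₀).symm q) < m) :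
    ∃ γ : ℝ → N, γ 0 = (extChartAt 𝓘(ℝ, E) x₀).symm q ∧ IsMIntegralCurveOn γ X (Ici 0) := by
  obtain ⟨β, rfl, hβ⟩ := exists_forall_hasDerivAt_of_hasCompactSupport hv hsupp q
  have hcurve : ∀ s : Set ℝ, (∀ t ∈ s, β t ∈ closedBall (extChartAt 𝓘(ℝ, E) x₀ x₀) r) →
      IsMIntegralCurveOn ((extChartAt 𝓘(ℝ, E) x₀).symm ∘ β) X s := fun s hs ↦
    isMIntegralCurveOn_extChartAt_symm_comp (fun t ht ↦ hB.subset_target (hs t ht))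
      fun t ht ↦ hvX _ (hs t ht) ▸ hβ t
  have hstay : ∀ t ∈ Ici (0 : ℝ), β t ∈ ball (extChartAt 𝓘(ℝ, E) x₀ x₀) r := fun t ht ↦
    mem_of_le_initial isClosed_closedBall isOpen_ball ball_subset_closedBall
      (f := h ∘ (extChartAt 𝓘(ℝ, E) x₀).symm)
      (fun p hp ↦ hB.le_of_mem_sphere p (by rwa [← closedBall_sdiff_ball])) ht
      (fun s _ ↦ (hβ s).continuousAt.continuousWithinAt) hq hqm
      fun s hs hsB ↦ le_of_isMIntegralCurveOn (γ := (extChartAt 𝓘(ℝ, E) x₀).symm ∘ β) hs.1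
        (hcurve _ hsB) (fun u hu ↦ hB.mdifferentiableAt _ (hsB u hu))
        fun u hu ↦ hB.mvfderiv_nonpos _ (hsB u hu)
  exact ⟨_, rfl, hcurve _ fun t ht ↦ ball_subset_closedBall (hstay t ht)⟩

theorem isStableEquilibrium_of_strict_local_min [T2Space N]
    (hX : ContMDiffAt 𝓘(ℝ, E) 𝓘(ℝ, E).tangent 1
      (fun x ↦ (⟨x, X x⟩ : TangentBundle 𝓘(ℝ, E) N)) x₀) (hx₀ : X x₀ = 0)
    (hh : ∀ᶠ x in 𝓝 x₀, MDifferentiableAt 𝓘(ℝ, E) 𝓘(ℝ, ℝ) h x)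
    (hXh : ∀ᶠ x in 𝓝 x₀, mvfderiv 𝓘(ℝ, E) h x (X x) ≤ 0)
    (hmin : ∀ᶠ x in 𝓝 x₀, x ≠ x₀ → h x₀ < h x) : IsStableEquilibrium X x₀ := by
  refine ⟨hx₀, fun U hU ↦ ?_⟩
  obtain ⟨v, hv, hsupp, hvX⟩ :=
    exists_contDiff_hasCompactSupport_eventuallyEq (n := 1) (contDiffAt_coordField hX)
  obtain ⟨r, m, hr, hm, hB, hball⟩ := exists_isLyapunovBall hh hXh hmin
    (hvX.and ((tendsto_extChartAt_symm x₀).eventually hU))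
  have hball_nhds : ∀ᶠ x in 𝓝 x₀, extChartAt 𝓘(ℝ, E) x₀ x ∈ ball (extChartAt 𝓘(ℝ, E) x₀ x₀) r :=
    (continuousAt_extChartAt x₀).eventually (ball_mem_nhds _ hr)
  have hlt_nhds : ∀ᶠ x in 𝓝 x₀, h x < m := hh.self_of_nhds.continuousAt.eventually_lt_const hm
  refine ⟨_, inter_mem (extChartAt_source_mem_nhds (I := 𝓘(ℝ, E)) x₀) (hball_nhds.and hlt_nhds), ?_⟩
  rintro y ⟨hys, hyb, hym⟩
  have hy : (extChartAt 𝓘(ℝ, E) x₀).symm (extChartAt 𝓘(ℝ, E) x₀ y) = y :=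
    (extChartAt 𝓘(ℝ, E) x₀).left_inv hys
  constructor
  · simpa only [hy] using hB.exists_isMIntegralCurveOn_Ici hv hsupp (fun q hq ↦ (hball q hq).1)
      hyb (by rwa [hy])
  · rintro γ T rfl hγ t ht
    obtain ⟨q, hq, hqt⟩ := hB.mem_image_ball ht.1
      (hγ.mono fun s hs ↦ ⟨hs.1, hs.2.trans_lt ht.2⟩) ⟨_, hyb, hy⟩ hym
    exact hqt ▸ (hball q (ball_subset_closedBall hq)).2

end Lyapunov

section SecondOrderCondition

variable {E : Type*} [NormedAddCommGroup E] [NormedSpace ℝ E] [FiniteDimensional ℝ E]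
  {M : Type*} [TopologicalSpace M] [ChartedSpace E M] [IsManifold 𝓘(ℝ, E) ∞ M]
  {E' : Type*} [NormedAddCommGroup E'] [NormedSpace ℝ E']
  {N : Type*} [TopologicalSpace N] [ChartedSpace E' N]
  (g : SmoothMetric E M) {i : N → M} {y₀ : N}

theorem eventually_lt_of_fderiv_fderiv_comp_extChartAt_symm_pos [FiniteDimensional ℝ E']
    {f : N → ℝ} (hf : ContMDiffAt 𝓘(ℝ, E') 𝓘(ℝ, ℝ) 2 f y₀) (hcrit : mvfderiv 𝓘(ℝ, E') f y₀ = 0)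
    (hpos : ∀ u, u ≠ 0 → 0 < fderiv ℝ (fderiv ℝ (f ∘ (extChartAt 𝓘(ℝ, E') y₀).symm))
      (extChartAt 𝓘(ℝ, E') y₀ y₀) u u) :
    ∀ᶠ y in 𝓝 y₀, y ≠ y₀ → f y₀ < f y := by
  have hchart := eventually_lt_of_fderiv_fderiv_pos (contDiffAt_comp_extChartAt_symm hf)
    ((mvfderiv_eq_fderiv_comp_extChartAt_symm (hf.mdifferentiableAt two_ne_zero)).symm.trans hcrit)
    hpos
  filter_upwards [(continuousAt_extChartAt (I := 𝓘(ℝ, E')) y₀).eventually hchart,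
    extChartAt_source_mem_nhds (I := 𝓘(ℝ, E')) y₀] with y hy hys hne
  have hlt := hy ((extChartAt 𝓘(ℝ, E') y₀).injOn.ne hys (mem_extChartAt_source y₀) hne)
  rwa [Function.comp_apply, Function.comp_apply, (extChartAt 𝓘(ℝ, E') y₀).left_inv hys,
    extChartAt_to_inv] at hlt

theorem mvfderiv_eq_zero_of_grad_eq_zero {Φ : M → ℝ} {x : M} (hgrad : grad g Φ x = 0) :
    mvfderiv 𝓘(ℝ, E) Φ x = 0 := by
  ext w
  rw [← inner_sharp g x (mvfderiv 𝓘(ℝ, E) Φ x) w, ← grad, hgrad]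
  simp

theorem hess_eq_fderiv_fderiv_of_grad_eq_zero {Φ : M → ℝ} {x : M}
    (hΦ : ContMDiffAt 𝓘(ℝ, E) 𝓘(ℝ, ℝ) 2 Φ x) (hgrad : grad g Φ x = 0)
    (v w : TangentSpace 𝓘(ℝ, E) x) :
    hess g Φ x v w =
      fderiv ℝ (fderiv ℝ (Φ ∘ (extChartAt 𝓘(ℝ, E) x).symm)) (extChartAt 𝓘(ℝ, E) x x) v w := by
  rw [hess_eq_fderiv_fderiv_sub_christoffelFirst g hΦ, hgrad]
  exact sub_eq_self.2 (map_zero _)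

theorem fderiv_fderiv_comp_extChartAt_symm_eq_hess {Φ : M → ℝ}
    (hΦ : ContMDiffAt 𝓘(ℝ, E) 𝓘(ℝ, ℝ) 2 Φ (i y₀)) (hi : ContMDiffAt 𝓘(ℝ, E') 𝓘(ℝ, E) 2 i y₀)
    (hgrad : grad g Φ (i y₀) = 0) (u w : TangentSpace 𝓘(ℝ, E') y₀) :
    fderiv ℝ (fderiv ℝ ((Φ ∘ i) ∘ (extChartAt 𝓘(ℝ, E') y₀).symm)) (extChartAt 𝓘(ℝ, E') y₀ y₀) u w =
      hess g Φ (i y₀) (mfderiv 𝓘(ℝ, E') 𝓘(ℝ, E) i y₀ u) (mfderiv 𝓘(ℝ, E') 𝓘(ℝ, E) i y₀ w) := by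
  let j : E' → E := writtenInExtChartAt 𝓘(ℝ, E') 𝓘(ℝ, E) y₀ i
  have hj₀ : j (extChartAt 𝓘(ℝ, E') y₀ y₀) = extChartAt 𝓘(ℝ, E) (i y₀) (i y₀) :=
    congrArg (extChartAt 𝓘(ℝ, E) (i y₀) ∘ i) (extChartAt_to_inv y₀)
  have hcoord : (Φ ∘ i) ∘ (extChartAt 𝓘(ℝ, E') y₀).symm =ᶠ[𝓝 (extChartAt 𝓘(ℝ, E') y₀ y₀)]
      (Φ ∘ (extChartAt 𝓘(ℝ, E) (i y₀)).symm) ∘ j := by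
    filter_upwards [(tendsto_extChartAt_symm y₀).eventually
      (hi.continuousAt.eventually (extChartAt_source_mem_nhds (I := 𝓘(ℝ, E)) (i y₀)))] with q hq
    exact congrArg Φ ((extChartAt 𝓘(ℝ, E) (i y₀)).left_inv hq).symm
  have hcrit : fderiv ℝ (Φ ∘ (extChartAt 𝓘(ℝ, E) (i y₀)).symm)
      (j (extChartAt 𝓘(ℝ, E') y₀ y₀)) = 0 := by
    rw [hj₀, ← mvfderiv_eq_fderiv_comp_extChartAt_symm (hΦ.mdifferentiableAt two_ne_zero)]
    exact mvfderiv_eq_zero_of_grad_eq_zero g hgrad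
  have hchart : ContDiffAt ℝ 2 (Φ ∘ (extChartAt 𝓘(ℝ, E) (i y₀)).symm)
      (j (extChartAt 𝓘(ℝ, E') y₀ y₀)) := hj₀ ▸ contDiffAt_comp_extChartAt_symm hΦ
  calc _ = fderiv ℝ (fderiv ℝ ((Φ ∘ (extChartAt 𝓘(ℝ, E) (i y₀)).symm) ∘ j))
        (extChartAt 𝓘(ℝ, E') y₀ y₀) u w := by rw [hcoord.fderiv.fderiv_eq]
    _ = fderiv ℝ (fderiv ℝ (Φ ∘ (extChartAt 𝓘(ℝ, E) (i y₀)).symm)) (j (extChartAt 𝓘(ℝ, E') y₀ y₀))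
        (fderiv ℝ j (extChartAt 𝓘(ℝ, E') y₀ y₀) u) (fderiv ℝ j (extChartAt 𝓘(ℝ, E') y₀ y₀) w) :=
      fderiv_fderiv_comp_of_fderiv_eq_zero hchart (contDiffAt_writtenInExtChartAt hi) hcrit u w
    _ = _ := by
      rw [hess_eq_fderiv_fderiv_of_grad_eq_zero g hΦ hgrad, hj₀,
        mfderiv_eq_fderiv_writtenInExtChartAt (hi.mdifferentiableAt two_ne_zero)]
      rfl

variable [FiniteDimensional ℝ E']

theorem eventually_lt_of_hess_pos {Φ : M → ℝ} (hΦ : ContMDiffAt 𝓘(ℝ, E) 𝓘(ℝ, ℝ) 2 Φ (i y₀))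
    (hi : ContMDiffAt 𝓘(ℝ, E') 𝓘(ℝ, E) 2 i y₀)
    (hinj : Function.Injective (mfderiv 𝓘(ℝ, E') 𝓘(ℝ, E) i y₀)) (hgrad : grad g Φ (i y₀) = 0)
    (hpos : ∀ v ∈ (mfderiv 𝓘(ℝ, E') 𝓘(ℝ, E) i y₀).range, v ≠ 0 → 0 < hess g Φ (i y₀) v v) :
    ∀ᶠ y in 𝓝 y₀, y ≠ y₀ → Φ (i y₀) < Φ (i y) := by
  refine eventually_lt_of_fderiv_fderiv_comp_extChartAt_symm_pos (hΦ.comp y₀ hi) ?_ fun u hu ↦ ?_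
  · ext u
    rw [mvfderiv_comp_apply y₀ (hΦ.mdifferentiableAt two_ne_zero)
      (hi.mdifferentiableAt two_ne_zero), mvfderiv_eq_zero_of_grad_eq_zero g hgrad]
    simp
  · exact (hpos _ ⟨u, rfl⟩ ((map_ne_zero_iff _ hinj).2 hu)).trans_eq
      (fderiv_fderiv_comp_extChartAt_symm_eq_hess g hΦ hi hgrad u u).symm

theorem eventually_lt_of_hess_sub_sum_pos {κ : Type*} [Fintype κ] {G : M → ℝ} {f : κ → M → ℝ}
    (hG : ContMDiffAt 𝓘(ℝ, E) 𝓘(ℝ, ℝ) 2 G (i y₀))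
    (hf : ∀ a, ContMDiffAt 𝓘(ℝ, E) 𝓘(ℝ, ℝ) 2 (f a) (i y₀))
    (hi : ContMDiffAt 𝓘(ℝ, E') 𝓘(ℝ, E) 2 i y₀)
    (hinj : Function.Injective (mfderiv 𝓘(ℝ, E') 𝓘(ℝ, E) i y₀))
    (hconst : ∀ a, ∀ᶠ y in 𝓝 y₀, f a (i y) = f a (i y₀)) (σ : κ → ℝ)
    (hgrad : grad g G (i y₀) = ∑ a, σ a • grad g (f a) (i y₀))
    (hpos : ∀ v ∈ (mfderiv 𝓘(ℝ, E') 𝓘(ℝ, E) i y₀).range, v ≠ 0 →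
      0 < hess g G (i y₀) v v - ∑ a, σ a * hess g (f a) (i y₀) v v) :
    ∀ᶠ y in 𝓝 y₀, y ≠ y₀ → G (i y₀) < G (i y) := by
  have hcrit : grad g (lagrangeFunction G f σ) (i y₀) = 0 := by
    rw [grad_lagrangeFunction g (hG.mdifferentiableAt two_ne_zero)
      fun a ↦ (hf a).mdifferentiableAt two_ne_zero, hgrad, sub_self]
  have hmin := eventually_lt_of_hess_pos g (contMDiffAt_lagrangeFunction hG hf σ) hi hinj hcrit
    fun v hv hv₀ ↦ (hpos v hv hv₀).trans_eq (hess_lagrangeFunction g hG hf σ v v).symm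
  filter_upwards [hmin, eventually_all.2 hconst] with y hy hfy hne
  simpa only [lagrangeFunction, hfy, sub_lt_sub_iff_right] using hy hne

end SecondOrderCondition

section Immersion

variable {E : Type*} [NormedAddCommGroup E] [NormedSpace ℝ E]
  {M : Type*} [TopologicalSpace M] [ChartedSpace E M]
  {E' : Type*} [NormedAddCommGroup E'] [NormedSpace ℝ E']
  {N : Type*} [TopologicalSpace N] [ChartedSpace E' N]

theorem injective_mfderiv_of_isImmersionAt {n : WithTop ℕ∞} (hn : 1 ≤ n)
    [IsManifold 𝓘(ℝ, E) n M] [IsManifold 𝓘(ℝ, E') n N] {f : N → M} {x : N}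
    (hf : Manifold.IsImmersionAt 𝓘(ℝ, E') 𝓘(ℝ, E) n f x) :
    Function.Injective (mfderiv 𝓘(ℝ, E') 𝓘(ℝ, E) f x) := by
  have : IsManifold 𝓘(ℝ, E) 1 M := IsManifold.of_le hn
  have : IsManifold 𝓘(ℝ, E') 1 N := IsManifold.of_le hn
  have hdom := IsManifold.maximalAtlas_subset_of_le hn hf.domChart_mem_maximalAtlas
  have hcod := IsManifold.maximalAtlas_subset_of_le hn hf.codChart_mem_maximalAtlas
  have hφ : hf.domChart.MDifferentiable 𝓘(ℝ, E') 𝓘(ℝ, E') :=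
    ⟨fun y hy ↦ (mdifferentiableAt_of_mem_maximalAtlas hdom hy).mdifferentiableWithinAt,
      fun y hy ↦ (mdifferentiableAt_symm_of_mem_maximalAtlas hdom hy).mdifferentiableWithinAt⟩
  let L : E' →L[ℝ] E := hf.equiv.toContinuousLinearMap ∘L ContinuousLinearMap.inl ℝ E' _
  have hL : Function.Injective L := fun a b hab ↦ by
    simpa [L] using hab
  have heq : hf.codChart ∘ f =ᶠ[𝓝 x] L ∘ hf.domChart := by
    filter_upwards [hf.domChart.open_source.mem_nhds hf.mem_domChart_source] with y hy
    have hmem : hf.domChart y ∈ (hf.domChart.extend 𝓘(ℝ, E')).target := by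
      simpa using hf.domChart.map_source hy
    simpa [hf.domChart.left_inv hy, L] using hf.writtenInCharts hmem
  have hcodf := (mdifferentiableAt_of_mem_maximalAtlas hcod
    hf.mem_codChart_source).hasMFDerivAt.comp x
      (hf.contMDiffAt.mdifferentiableAt (zero_lt_one.trans_le hn).ne').hasMFDerivAt
  have hLdom := L.hasMFDerivAt.comp x (hφ.mdifferentiableAt hf.mem_domChart_source).hasMFDerivAt
  have hderiv := hasMFDerivAt_unique hcodf (hLdom.congr_of_eventuallyEq heq)
  have hinj : Function.Injective (mfderiv 𝓘(ℝ, E) 𝓘(ℝ, E) hf.codChart (f x) ∘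
      mfderiv 𝓘(ℝ, E') 𝓘(ℝ, E) f x) := by
    rw [← ContinuousLinearMap.coe_comp, hderiv]
    exact hL.comp (hφ.mfderiv_injective hf.mem_domChart_source)
  exact hinj.of_comp

end Immersion

end ConstrainedStability

open Filter in
theorem theorem5p1_general
    {E : Type*} [NormedAddCommGroup E] [NormedSpace ℝ E] [FiniteDimensional ℝ E]
    {M : Type*} [TopologicalSpace M] [ChartedSpace E M] [IsManifold 𝓘(ℝ, E) ∞ M]
    (g : ConstrainedStability.SmoothMetric E M)
    {E' : Type*} [NormedAddCommGroup E'] [NormedSpace ℝ E'] [FiniteDimensional ℝ E']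
    {N : Type*} [TopologicalSpace N] [T2Space N] [ChartedSpace E' N] [IsManifold 𝓘(ℝ, E') 1 N]
    {i : N → M} {x_e : N} (hi : ContMDiffAt 𝓘(ℝ, E') 𝓘(ℝ, E) 2 i x_e)
    (hinj : Function.Injective (mfderiv 𝓘(ℝ, E') 𝓘(ℝ, E) i x_e))
    {X : (x : N) → TangentSpace 𝓘(ℝ, E') x}
    (hX : ContMDiffAt 𝓘(ℝ, E') 𝓘(ℝ, E').tangent 1
      (fun x ↦ (⟨x, X x⟩ : TangentBundle 𝓘(ℝ, E') N)) x_e) (hx_e : X x_e = 0)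
    {κ : Type*} [Fintype κ] {f : κ → M → ℝ}
    (hf : ∀ a, ContMDiffAt 𝓘(ℝ, E) 𝓘(ℝ, ℝ) 2 (f a) (i x_e))
    (hconst : ∀ a, ∀ᶠ x in 𝓝 x_e, f a (i x) = f a (i x_e))
    {G : M → ℝ} (hG : ContMDiffAt 𝓘(ℝ, E) 𝓘(ℝ, ℝ) 2 G (i x_e)) (σ : κ → ℝ)
    (h₁ : ∀ᶠ x in 𝓝 x_e, mvfderiv 𝓘(ℝ, E) G (i x) (mfderiv 𝓘(ℝ, E') 𝓘(ℝ, E) i x (X x)) ≤ 0)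
    (h₂ : ConstrainedStability.grad g G (i x_e) =
      ∑ a, σ a • ConstrainedStability.grad g (f a) (i x_e))
    (h₃ : ∀ v ∈ (mfderiv 𝓘(ℝ, E') 𝓘(ℝ, E) i x_e).range, v ≠ 0 →
      0 < ConstrainedStability.hess g G (i x_e) v v -
        ∑ a, σ a * ConstrainedStability.hess g (f a) (i x_e) v v) :
    ConstrainedStability.IsStableEquilibrium X x_e := by
  have : IsManifold 𝓘(ℝ, E) 1 M := IsManifold.of_le (n := ∞) (by simp)
  have hi_nhds : ∀ᶠ x in 𝓝 x_e, MDifferentiableAt 𝓘(ℝ, E') 𝓘(ℝ, E) i x :=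
    ((contMDiffAt_iff_contMDiffAt_nhds (by simp)).1 (hi.of_le one_le_two)).mono
      fun _ h ↦ h.mdifferentiableAt one_ne_zero
  have hG_nhds : ∀ᶠ x in 𝓝 x_e, MDifferentiableAt 𝓘(ℝ, E) 𝓘(ℝ, ℝ) G (i x) :=
    (hi.continuousAt.eventually ((contMDiffAt_iff_contMDiffAt_nhds (by simp)).1
      (hG.of_le one_le_two))).mono fun _ h ↦ h.mdifferentiableAt one_ne_zero
  refine ConstrainedStability.isStableEquilibrium_of_strict_local_min hX hx_e (h := G ∘ i) ?_ ?_
    (ConstrainedStability.eventually_lt_of_hess_sub_sum_pos g hG hf hi hinj hconst σ h₂ h₃)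
  · filter_upwards [hi_nhds, hG_nhds] with x hix hGx using hGx.comp x hix
  · filter_upwards [hi_nhds, hG_nhds, h₁] with x hix hGx hx
    rwa [mvfderiv_comp_apply x hGx hix]

theorem theorem5p1
    -- the ambient Riemannian manifold `(M, g)`
    {E : Type*} [NormedAddCommGroup E] [NormedSpace ℝ E] [FiniteDimensional ℝ E]
    {M : Type*} [TopologicalSpace M] [T2Space M] [ChartedSpace E M] [IsManifold 𝓘(ℝ, E) ∞ M]
    (g : ConstrainedStability.SmoothMetric E M)
    -- the submanifold `S`, the preimage of a regular value `c` of `F : M → ℝ^k`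
    {k : ℕ} (F : M → EuclideanSpace ℝ (Fin k)) (c : EuclideanSpace ℝ (Fin k))
    (hF : ContMDiff 𝓘(ℝ, E) 𝓘(ℝ, EuclideanSpace ℝ (Fin k)) ∞ F)
    (hc : ConstrainedStability.IsRegularValue (E := E) F c)
    {E' : Type*} [NormedAddCommGroup E'] [NormedSpace ℝ E'] [FiniteDimensional ℝ E']
    (S : Set M) (hS : S = F ⁻¹' {c})
    [ChartedSpace E' S] [IsManifold 𝓘(ℝ, E') ∞ S]
    (hSM : Manifold.IsSmoothEmbedding 𝓘(ℝ, E') 𝓘(ℝ, E) ∞ (Subtype.val : S → M))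
    -- the vector field `X_S` on `S` with the equilibrium `x_e`, and its extension `X` to `M`
    (X_S : (x : S) → TangentSpace 𝓘(ℝ, E') x)
    (hX_S : ConstrainedStability.IsSmoothVectorField X_S)
    (x_e : S) (hx_e : X_S x_e = 0)
    (X : (x : M) → TangentSpace 𝓘(ℝ, E) x)
    (hX : ConstrainedStability.IsSmoothVectorField X)
    (hXX_S : ∀ x : S, X x = mfderiv 𝓘(ℝ, E') 𝓘(ℝ, E) (Subtype.val : S → M) x (X_S x))
    -- the function `G_S` on `S` and its `C²` extension `G` to `M`
    (G_S : S → ℝ) (G : M → ℝ) (hG : ContMDiff 𝓘(ℝ, E) 𝓘(ℝ, ℝ) 2 G)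
    (hGG_S : ∀ x : S, G x = G_S x)
    -- (i)
    (h₁ : ∀ x : M, mvfderiv 𝓘(ℝ, E) G x (X x) ≤ 0)
    -- (ii)
    (h₂ : ConstrainedStability.grad g G x_e =
      ∑ i : Fin k, ConstrainedStability.multiplier g (fun j y ↦ F y j) G i x_e •
        ConstrainedStability.grad g (fun y ↦ F y i) x_e)
    -- (iii)
    (h₃ : ∀ v ∈ ConstrainedStability.tangentSubspace (E := E) (E' := E') x_e, v ≠ 0 →
      0 < ConstrainedStability.hess g G x_e v v -
        ∑ i : Fin k, ConstrainedStability.multiplier g (fun j y ↦ F y j) G i x_e *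
          ConstrainedStability.hess g (fun y ↦ F y i) x_e v v) :
    ConstrainedStability.IsStableEquilibrium X_S x_e := by
  have : IsManifold 𝓘(ℝ, E') 1 S := IsManifold.of_le (n := ∞) (by simp)
  have hval : ContMDiff 𝓘(ℝ, E') 𝓘(ℝ, E) 2 (Subtype.val : S → M) :=
    hSM.contMDiff.of_le ENat.LEInfty.out
  have hval_inj : Function.Injective (mfderiv 𝓘(ℝ, E') 𝓘(ℝ, E) (Subtype.val : S → M) x_e) :=
    ConstrainedStability.injective_mfderiv_of_isImmersionAt (by simp)
      (hSM.isImmersion.isImmersionAt x_e)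
  have hX_S' : ContMDiff 𝓘(ℝ, E') 𝓘(ℝ, E').tangent 1
      (fun x ↦ (⟨x, X_S x⟩ : TangentBundle 𝓘(ℝ, E') S)) := ContMDiff.of_le hX_S (by simp)
  have hF_apply (a : Fin k) : ContMDiff 𝓘(ℝ, E) 𝓘(ℝ, ℝ) 2 (fun y ↦ F y a) :=
    (EuclideanSpace.proj (𝕜 := ℝ) a).contMDiff.comp (hF.of_le (m := 2) ENat.LEInfty.out)
  have hF_val (x : S) : F x = c := hS.subset x.2
  exact theorem5p1_general g (hval x_e) hval_inj (hX_S' x_e) hx_e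
    (f := fun a y ↦ F y a) (fun a ↦ hF_apply a x_e)
    (fun a ↦ .of_forall fun x ↦ by simp only [hF_val]) (hG x_e)
    (fun a ↦ ConstrainedStability.multiplier g (fun j y ↦ F y j) G a x_e)
    (.of_forall fun x ↦ hXX_S x ▸ h₁ x) h₂ h₃
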